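/- Say that $G:\mathbb R\to[0,\infty)$ has property $\mathcal P$ if: (1) $G$ is nondecreasing and convex on $[0,\infty)$; (2) $G(0)=0$, $G(1)=1$ and $G(-x)=G(x)$ for all $x$; (3) there is $s>0$ with $G(x)=sx+(1-s)$ for all $x>1$; (4) there is $\delta_G>0$ such that $G$ is twice differentiable on $(0,\delta_G)$, the right derivative $G'_+(0)$ exists, $G''_+(0)=\lim_{h\to0^+}(G'(h)-G'_+(0))/h$ exists (the value $+\infty$ being allowed), and $G'_+(0)>0$ or $G''_+(0)>0$; (5) there is $C_G>0$ with $G(y)\le C_G\,(y/x)^2\,G(x)$ for all $0<x<y$. For $x\in\mathbb R^n$ let $\|x\|_G=\inf\{\alpha>0 : \sum_{i=1}^n G(|x_i|/\alpha)\le 1\}$. Theorem. There are absolute constants $c,C>0$, and for every $G$ with property $\mathcal P$ there are constants $\alpha'_G,\alpha''_G\ge 1$ depending only on $G$, such that the following holds for all $n\ge 2$, all $m$ and every matrix $A\in\mathbb R^{n\times m}$, with $d$ the rank of $A$. Let $D\in\mathbb R^{n\times n}$ be a random diagonal matrix whose diagonal entries are i.i.d. nonnegative random variables with cumulative distribution function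 $t\mapsto 1-e^{-G(t)}$, $t\ge 0$. Then with probability at least $0.98$ the matrix $D$ is invertible and, for all $x\in\mathbb R^m$ simultaneously, $$\frac{c}{\alpha'_G\, d\log n}\,\|Ax\|_G\ \le\ \|D^{-1}Ax\|_2\ \le\ C\,\alpha''_G\, d^2\log n\,\|Ax\|_G .$$ (If $A=0$, so $d=0$, all three terms are read as $0$.) -/

import Mathlib

open Filter Topology

namespace OrliczEmbedding

/-- Property `P` of a function `G : ℝ → ℝ₊`.  The right second derivative of `G` at `0` is the
limit of `(G'(h) - G'₊(0)) / h` as `h → 0⁺`; it is allowed to be `+∞` (as for `|x| ^ p` with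
`1 < p < 2`).  The growth condition `G y / G x ≤ C (y / x) ^ 2` is written without division by
`G x`, which forces `G x > 0` for `x > 0`. -/
structure PropertyP (G : ℝ → ℝ) : Prop where
  nonneg : ∀ x, 0 ≤ G x
  monotoneOn : MonotoneOn G (Set.Ici 0)
  convexOn : ConvexOn ℝ (Set.Ici 0) G
  map_zero : G 0 = 0
  map_one : G 1 = 1
  even : ∀ x, G (-x) = G x
  linear : ∃ s : ℝ, 0 < s ∧ ∀ x, 1 < x → G x = s * x + (1 - s)
  smooth : ∃ δ : ℝ, 0 < δ ∧
    DifferentiableOn ℝ G (Set.Ioo 0 δ) ∧ DifferentiableOn ℝ (deriv G) (Set.Ioo 0 δ) ∧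
    ∃ (a : ℝ) (b : EReal),
      HasDerivWithinAt G a (Set.Ioi 0) 0 ∧
      Tendsto (fun h : ℝ => (((deriv G h - a) / h : ℝ) : EReal)) (𝓝[>] 0) (𝓝 b) ∧
      (0 < a ∨ 0 < b)
  subquadratic : ∃ C : ℝ, 0 < C ∧ ∀ x y, 0 < x → x < y → G y ≤ C * (y / x) ^ 2 * G x

/-- The Orlicz norm of `x ∈ ℝⁿ` induced by `G`. -/
noncomputable def orliczNorm (G : ℝ → ℝ) {n : ℕ} (x : Fin n → ℝ) : ℝ :=
  sInf {α : ℝ | 0 < α ∧ ∑ i, G (|x i| / α) ≤ 1}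

/-- The Euclidean norm of `x ∈ ℝⁿ`. -/
noncomputable def l2Norm {n : ℕ} (x : Fin n → ℝ) : ℝ :=
  ‖WithLp.toLp 2 x‖

end OrliczEmbedding

/-! ### Auerbach bases. -/

namespace OrliczEmbedding

/-! Take an Auerbach basis `U` of the column space for the Orlicz norm: its vectors lie in the unit
ball and the coefficients of `y` are at most `‖y‖_G`. So `D⁻¹` stretches `y` by at most `∑ j, ‖D⁻¹ U
j‖₂`, and it suffices to bound this one random sum.

Upper bound: `P(u ≤ t) ≤ G t`, and quadratic growth of `G` makes each of the roughly `log n` dyadic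
levels of a truncated ratio `|y i| / u i` contribute `O(G (y i))` to its second moment. The sum over
`i` is controlled by `∑ G (y i) ≤ 1`, and Markov finishes; truncation at height `~ d` is harmless by
a union bound. No independence is needed here.

Lower bound: by independence, all `u i` exceed `K |y i|` with probability `exp(-∑ G(K |y i|))`, at
most `exp(-K/4)` once `‖y‖_G ≥ 1/2`, by convexity. With `K ~ d log n` this beats the `n^O(d)` points
of a coefficient grid. At every relevant grid point some coordinate of `D⁻¹ y` is then at least
`1/K`, and the upper bound controls the rounding error. -/

open Module in
/-- Auerbach's lemma: a finite-dimensional real normed space has a basis of vectors in the unit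
ball whose coordinate functionals have norm at most one. -/
theorem exists_auerbach_basis (V : Type*) [NormedAddCommGroup V] [NormedSpace ℝ V]
    [FiniteDimensional ℝ V] :
    ∃ b : Basis (Fin (finrank ℝ V)) ℝ V, (∀ j, ‖b j‖ ≤ 1) ∧ ∀ x j, |b.repr x j| ≤ ‖x‖ := by
  let e := finBasis ℝ V
  have hcont : Continuous fun v : Fin (finrank ℝ V) → V => |e.det v| := by
    have : Continuous fun v : Fin (finrank ℝ V) → V => (e.toMatrix v).det := by
      refine Continuous.matrix_det (continuous_matrix fun i j => ?_)
      exact (LinearMap.continuous_of_finiteDimensional (e.coord i)).comp (continuous_apply j)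
    exact this.abs
  have hcomp : IsCompact (Set.univ.pi fun _ : Fin (finrank ℝ V) => Metric.closedBall (0 : V) 1) :=
    isCompact_univ_pi fun _ => isCompact_closedBall _ _
  -- Choose unit-ball vectors of maximal volume: replacing `v j` by another unit-ball vector
  -- multiplies the determinant by a coordinate (Cramer), which therefore has modulus at most one.
  obtain ⟨v, hv, hmax⟩ := hcomp.exists_isMaxOn ⟨0, by simp [Set.mem_pi]⟩ hcont.continuousOn
  have hv1 : ∀ j, ‖v j‖ ≤ 1 := by simpa [Set.mem_pi] using hv
  have hmax' : ∀ w : Fin (finrank ℝ V) → V, (∀ j, ‖w j‖ ≤ 1) → |e.det w| ≤ |e.det v| :=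
    fun w hw => hmax (by simpa [Set.mem_pi] using hw)
  have hpos : 0 < |e.det v| := by
    refine lt_of_lt_of_le ?_ (hmax' (fun i => (1 + ‖e i‖)⁻¹ • e i) fun j => ?_)
    · rw [e.det.map_smul_univ (fun i => (1 + ‖e i‖)⁻¹) e, e.det_self]
      have : ∏ i, (1 + ‖e i‖)⁻¹ ≠ 0 := Finset.prod_ne_zero_iff.2 fun i _ => by positivity
      simpa using this
    · rw [norm_smul, norm_inv, Real.norm_of_nonneg (by positivity), inv_mul_le_iff₀ (by positivity)]
      linarith
  have hunit : IsUnit (e.det v) := isUnit_iff_ne_zero.2 (abs_pos.1 hpos)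
  obtain ⟨hli, hsp⟩ := (Basis.is_basis_iff_det e).2 hunit
  let b := Basis.mk hli hsp.ge
  have hb : ∀ j, b j = v j := fun j => by simp [b]
  have hrepr : ∀ x j, e.det (Function.update v j x) = b.repr x j * e.det v := by
    intro x j
    conv_lhs => rw [← b.sum_repr x]
    rw [← AlternatingMap.coe_multilinearMap, MultilinearMap.map_update_sum,
      Finset.sum_eq_single j]
    · rw [MultilinearMap.map_update_smul, hb, Function.update_eq_self]
      rfl
    · intro i _ hij
      rw [MultilinearMap.map_update_smul, hb, AlternatingMap.coe_multilinearMap,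
        e.det.map_update_self v hij.symm, smul_zero]
    · simp
  have hunitball : ∀ x j, ‖x‖ ≤ 1 → |b.repr x j| ≤ 1 := by
    intro x j hx
    have h := hmax' (Function.update v j x) fun i => by
      by_cases h : i = j
      · subst h; simpa using hx
      · simpa [h] using hv1 i
    rw [hrepr, abs_mul] at h
    exact le_of_mul_le_mul_right (by simpa using h) hpos
  refine ⟨b, fun j => by rw [hb]; exact hv1 j, fun x j => ?_⟩
  rcases eq_or_ne x 0 with rfl | hx
  · simp
  have hx' : 0 < ‖x‖ := norm_pos_iff.2 hx
  have h := hunitball (‖x‖⁻¹ • x) j (by simp [norm_smul, hx'.ne'])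
  rw [map_smul, Finsupp.smul_apply, smul_eq_mul, abs_mul, abs_inv, abs_norm,
    inv_mul_le_iff₀ hx', mul_one] at h
  exact h

open Module in
/-- Auerbach's lemma for a norm given as a function. -/
theorem exists_auerbach_basis_of_norm (V : Type*) [AddCommGroup V] [Module ℝ V]
    [FiniteDimensional ℝ V] (N : V → ℝ) (h0 : N 0 = 0) (hadd : ∀ x y, N (x + y) ≤ N x + N y)
    (hsmul : ∀ (c : ℝ) x, N (c • x) = |c| * N x) (hdef : ∀ x, N x = 0 → x = 0) :
    ∃ b : Basis (Fin (finrank ℝ V)) ℝ V, (∀ j, N (b j) ≤ 1) ∧ ∀ x j, |b.repr x j| ≤ N x := by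
  let N' : AddGroupNorm V :=
    { toFun := N
      map_zero' := h0
      add_le' := hadd
      neg' := fun x => by simpa using hsmul (-1) x
      eq_zero_of_map_eq_zero' := hdef }
  let _ : NormedAddCommGroup V := N'.toNormedAddCommGroup
  let _ : NormedSpace ℝ V := { norm_smul_le := fun c x => (hsmul c x).le }
  exact exists_auerbach_basis V

/-! ### Convexity of `G` and the Orlicz norm. -/

variable {G : ℝ → ℝ}

theorem PropertyP.apply_mul_le (hG : PropertyP G) {t x : ℝ} (ht : 0 ≤ t) (ht1 : t ≤ 1)
    (hx : 0 ≤ x) : G (t * x) ≤ t * G x := by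
  have h := hG.convexOn.2 (Set.mem_Ici.2 hx) (Set.mem_Ici.2 le_rfl) ht (sub_nonneg.2 ht1)
    (by ring)
  simpa [hG.map_zero] using h

theorem PropertyP.mul_le_apply (hG : PropertyP G) {t x : ℝ} (ht : 1 ≤ t) (hx : 0 ≤ x) :
    t * G x ≤ G (t * x) := by
  have ht0 : 0 < t := by linarith
  have h := hG.apply_mul_le (inv_nonneg.2 ht0.le) (inv_le_one_of_one_le₀ ht)
    (mul_nonneg ht0.le hx)
  rw [inv_mul_cancel_left₀ ht0.ne'] at h
  rwa [le_inv_mul_iff₀ ht0] at h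

theorem PropertyP.apply_le_self (hG : PropertyP G) {x : ℝ} (hx : 0 ≤ x) (hx1 : x ≤ 1) :
    G x ≤ x := by
  simpa [hG.map_one] using hG.apply_mul_le hx hx1 zero_le_one

variable {n : ℕ}

theorem orliczNorm_nonneg (x : Fin n → ℝ) : 0 ≤ orliczNorm G x :=
  Real.sInf_nonneg fun _ h => h.1.le

theorem orliczNorm_le {x : Fin n → ℝ} {α : ℝ} (hα : 0 < α) (h : ∑ i, G (|x i| / α) ≤ 1) :
    orliczNorm G x ≤ α :=
  csInf_le ⟨0, fun _ h => h.1.le⟩ ⟨hα, h⟩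

/-- The strict inequality avoids having to show that the infimum is attained. Nonemptiness of the
defining set comes from `G t ≤ t` on `[0, 1]`. -/
theorem PropertyP.sum_le_one_of_lt (hG : PropertyP G) {x : Fin n → ℝ} {α : ℝ}
    (h : orliczNorm G x < α) : ∑ i, G (|x i| / α) ≤ 1 := by
  have hne : {α : ℝ | 0 < α ∧ ∑ i, G (|x i| / α) ≤ 1}.Nonempty := by
    have hs : 0 ≤ ∑ i, |x i| := Finset.sum_nonneg fun _ _ => abs_nonneg _
    refine ⟨1 + ∑ i, |x i|, by positivity, ?_⟩
    calc ∑ i, G (|x i| / (1 + ∑ i, |x i|)) ≤ ∑ i, |x i| / (1 + ∑ i, |x i|) := by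
          refine Finset.sum_le_sum fun i _ => hG.apply_le_self (by positivity) ?_
          rw [div_le_one (by positivity)]
          linarith [Finset.single_le_sum (f := fun i => |x i|) (fun _ _ => abs_nonneg _)
            (Finset.mem_univ i)]
      _ ≤ 1 := by
          rw [← Finset.sum_div, div_le_one (by positivity)]
          linarith
  obtain ⟨β, ⟨hβ, hβ1⟩, hβα⟩ := exists_lt_of_csInf_lt hne h
  refine le_trans (Finset.sum_le_sum fun i _ => ?_) hβ1
  have hα : 0 < α := hβ.trans hβα
  exact hG.monotoneOn (Set.mem_Ici.2 (by positivity)) (Set.mem_Ici.2 (by positivity))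
    (div_le_div_of_nonneg_left (abs_nonneg _) hβ hβα.le)

theorem PropertyP.orliczNorm_zero (hG : PropertyP G) : orliczNorm G (0 : Fin n → ℝ) = 0 := by
  refine le_antisymm (le_of_forall_pos_le_add fun ε hε => ?_) (orliczNorm_nonneg _)
  rw [zero_add]
  exact orliczNorm_le hε (by simp [hG.map_zero])

theorem PropertyP.orliczNorm_smul_le (hG : PropertyP G) (c : ℝ) (x : Fin n → ℝ) :
    orliczNorm G (c • x) ≤ |c| * orliczNorm G x := by
  rcases eq_or_ne c 0 with rfl | hc
  · simp [hG.orliczNorm_zero]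
  have hc' : 0 < |c| := abs_pos.2 hc
  rw [← div_le_iff₀' hc']
  refine le_of_forall_gt_imp_ge_of_dense fun β hβ => ?_
  have hβ0 : 0 < β := (orliczNorm_nonneg x).trans_lt hβ
  rw [div_le_iff₀' hc']
  refine orliczNorm_le (by positivity) ?_
  refine le_of_eq_of_le (Finset.sum_congr rfl fun i _ => ?_) (hG.sum_le_one_of_lt hβ)
  rw [Pi.smul_apply, smul_eq_mul, abs_mul, mul_div_mul_left _ _ hc'.ne']

theorem PropertyP.orliczNorm_smul (hG : PropertyP G) (c : ℝ) (x : Fin n → ℝ) :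
    orliczNorm G (c • x) = |c| * orliczNorm G x := by
  refine le_antisymm (hG.orliczNorm_smul_le c x) ?_
  rcases eq_or_ne c 0 with rfl | hc
  · simp [hG.orliczNorm_zero]
  have h := hG.orliczNorm_smul_le c⁻¹ (c • x)
  rwa [inv_smul_smul₀ hc, abs_inv, le_inv_mul_iff₀ (abs_pos.2 hc)] at h

theorem PropertyP.orliczNorm_add_le (hG : PropertyP G) (x y : Fin n → ℝ) :
    orliczNorm G (x + y) ≤ orliczNorm G x + orliczNorm G y := by
  refine le_of_forall_pos_le_add fun ε hε => ?_
  obtain ⟨a, ha⟩ : ∃ a, a = orliczNorm G x + ε / 2 := ⟨_, rfl⟩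
  obtain ⟨b, hb⟩ : ∃ b, b = orliczNorm G y + ε / 2 := ⟨_, rfl⟩
  have ha0 : 0 < a := by linarith [orliczNorm_nonneg (G := G) x]
  have hb0 : 0 < b := by linarith [orliczNorm_nonneg (G := G) y]
  have hx := hG.sum_le_one_of_lt (x := x) (α := a) (by linarith)
  have hy := hG.sum_le_one_of_lt (x := y) (α := b) (by linarith)
  have key : ∀ i, G (|(x + y) i| / (a + b)) ≤
      a / (a + b) * G (|x i| / a) + b / (a + b) * G (|y i| / b) := by
    intro i
    have hx0 : 0 ≤ |x i| / a := by positivity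
    have hy0 : 0 ≤ |y i| / b := by positivity
    have hconv := hG.convexOn.2 (Set.mem_Ici.2 hx0) (Set.mem_Ici.2 hy0)
      (show 0 ≤ a / (a + b) by positivity) (show 0 ≤ b / (a + b) by positivity) (by field_simp)
    refine le_trans (hG.monotoneOn (Set.mem_Ici.2 (by positivity)) (Set.mem_Ici.2 ?_) ?_) hconv
    · simp only [smul_eq_mul]; positivity
    · have : a / (a + b) * (|x i| / a) + b / (a + b) * (|y i| / b) = (|x i| + |y i|) / (a + b) := by
        field_simp
      simp only [smul_eq_mul]
      rw [this]
      exact div_le_div_of_nonneg_right (abs_add_le _ _) (by positivity)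
  have hle : orliczNorm G (x + y) ≤ a + b := by
    refine orliczNorm_le (by positivity) ((Finset.sum_le_sum fun i _ => key i).trans ?_)
    rw [Finset.sum_add_distrib, ← Finset.mul_sum, ← Finset.mul_sum]
    calc a / (a + b) * ∑ i, G (|x i| / a) + b / (a + b) * ∑ i, G (|y i| / b)
        ≤ a / (a + b) * 1 + b / (a + b) * 1 := by gcongr
      _ = 1 := by field_simp
  linarith

/-- At scale `|x i| / 2` a nonzero coordinate alone contributes `G 2 ≥ 2` by convexity. -/
theorem PropertyP.eq_zero_of_orliczNorm_eq_zero (hG : PropertyP G) {x : Fin n → ℝ}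
    (h : orliczNorm G x = 0) : x = 0 := by
  funext i
  by_contra hi
  have hi' : 0 < |x i| := abs_pos.2 hi
  have h1 := hG.sum_le_one_of_lt (x := x) (α := |x i| / 2) (by rw [h]; positivity)
  have h2 := (Finset.single_le_sum (f := fun j => G (|x j| / (|x i| / 2)))
    (fun _ _ => hG.nonneg _) (Finset.mem_univ i)).trans h1
  have h3 : |x i| / (|x i| / 2) = 2 * 1 := by field_simp
  have h4 := hG.mul_le_apply (t := 2) (by norm_num) zero_le_one
  simp only [h3] at h2
  rw [hG.map_one] at h4
  linarith

/-- A well-conditioned family spanning the column space of `A` in the Orlicz norm. -/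
theorem PropertyP.exists_wellConditioned (hG : PropertyP G) {m : ℕ}
    (A : Matrix (Fin n) (Fin m) ℝ) :
    ∃ U : Fin A.rank → Fin n → ℝ, (∀ j, orliczNorm G (U j) ≤ 1) ∧
      ∀ x, ∃ z : Fin A.rank → ℝ, A.mulVec x = ∑ j, z j • U j ∧
        ∀ j, |z j| ≤ orliczNorm G (A.mulVec x) := by
  obtain ⟨b, hb1, hb2⟩ := exists_auerbach_basis_of_norm (LinearMap.range A.mulVecLin)
    (fun y => orliczNorm G (y : Fin n → ℝ)) hG.orliczNorm_zero
    (fun x y => hG.orliczNorm_add_le _ _) (fun c x => hG.orliczNorm_smul c _)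
    (fun x hx => Subtype.ext (hG.eq_zero_of_orliczNorm_eq_zero hx))
  refine ⟨fun j => b j, hb1, fun x => ?_⟩
  let y : LinearMap.range A.mulVecLin := ⟨A.mulVec x, x, rfl⟩
  refine ⟨fun j => b.repr y j, ?_, fun j => hb2 y j⟩
  exact (congrArg Subtype.val (b.sum_repr y)).symm.trans
    (by
      simp only [Submodule.coe_sum, Submodule.coe_smul]
      rfl)

/-- Controls the Orlicz error of rounding coefficients to a grid. -/
theorem PropertyP.orliczNorm_sum_smul_le (hG : PropertyP G) {d : ℕ} {U : Fin d → Fin n → ℝ}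
    (hU : ∀ j, orliczNorm G (U j) ≤ 1) {z : Fin d → ℝ} {ε : ℝ} (hz : ∀ j, |z j| ≤ ε) :
    orliczNorm G (∑ j, z j • U j) ≤ d * ε := by
  have h := Finset.le_sum_of_subadditive (orliczNorm G) hG.orliczNorm_zero.le
    hG.orliczNorm_add_le Finset.univ fun j => z j • U j
  refine h.trans (le_of_le_of_eq (Finset.sum_le_sum fun j _ => ?_) (b := ∑ _j : Fin d, ε) (by simp))
  rw [hG.orliczNorm_smul]
  calc |z j| * orliczNorm G (U j) ≤ |z j| * 1 := by gcongr; exact hU j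
    _ ≤ ε := by simpa using hz j

end OrliczEmbedding

/-! ### Euclidean norm, distribution of the weights, and the two probabilistic estimates. -/

namespace OrliczEmbedding

open MeasureTheory ProbabilityTheory

variable {G : ℝ → ℝ} {n : ℕ}

theorem l2Norm_sq (x : Fin n → ℝ) : l2Norm x ^ 2 = ∑ i, x i ^ 2 := by
  simp [l2Norm, EuclideanSpace.norm_sq_eq]

theorem l2Norm_nonneg (x : Fin n → ℝ) : 0 ≤ l2Norm x := norm_nonneg _

theorem l2Norm_add_le (x y : Fin n → ℝ) : l2Norm (x + y) ≤ l2Norm x + l2Norm y :=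
  norm_add_le (WithLp.toLp 2 x) (WithLp.toLp 2 y)

theorem l2Norm_smul (c : ℝ) (x : Fin n → ℝ) : l2Norm (c • x) = |c| * l2Norm x :=
  norm_smul c (WithLp.toLp 2 x)

theorem l2Norm_zero : l2Norm (0 : Fin n → ℝ) = 0 := norm_zero

theorem abs_le_l2Norm (x : Fin n → ℝ) (i : Fin n) : |x i| ≤ l2Norm x := by
  refine abs_le_of_sq_le_sq (le_of_le_of_eq ?_ (l2Norm_sq x).symm) (l2Norm_nonneg x)
  exact Finset.single_le_sum (f := fun i => x i ^ 2) (fun _ _ => sq_nonneg _) (Finset.mem_univ i)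

/-- Used with `v` the diagonal of `D⁻¹`, both for the final upper bound and for the rounding error
on the grid. -/
theorem l2Norm_mul_sum_smul_le {d : ℕ} (v : Fin n → ℝ) (U : Fin d → Fin n → ℝ) {z : Fin d → ℝ}
    {ε B : ℝ} (hε : 0 ≤ ε) (hz : ∀ j, |z j| ≤ ε) (hB : ∑ j, l2Norm (v * U j) ≤ B) :
    l2Norm (v * ∑ j, z j • U j) ≤ ε * B := by
  rw [Finset.mul_sum]
  refine (Finset.le_sum_of_subadditive l2Norm l2Norm_zero.le l2Norm_add_le _ _).trans
    (le_trans ?_ (mul_le_mul_of_nonneg_left hB hε))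
  rw [Finset.mul_sum]
  refine Finset.sum_le_sum fun j _ => ?_
  rw [mul_smul_comm, l2Norm_smul]
  exact mul_le_mul_of_nonneg_right (hz j) (l2Norm_nonneg _)

/-- Dyadic bound on the square of a bounded ratio. -/
theorem sq_inv_mul_le {y v M : ℝ} (hy : 0 ≤ y) (hv : 0 < v) (hM : y ≤ M * v) (K : ℕ) :
    (v⁻¹ * y) ^ 2 ≤ (1 / 4) ^ K +
      ((∑ k ∈ Finset.range K, (1 / 4) ^ k * if v ≤ 2 ^ (k + 1) * y then (1 : ℝ) else 0) +
        M ^ 2 * if v ≤ y then 1 else 0) := by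
  have h0 : 0 ≤ v⁻¹ * y := by positivity
  -- Level `k` is charged when `y / v ≥ 2^-(k+1)`; otherwise the squared ratio is already below
  -- `4^-(k+1)`. Ratios of at least one are charged `M ^ 2`.
  induction K with
  | zero =>
    by_cases h : v ≤ y
    · have : v⁻¹ * y ≤ M := by rw [inv_mul_le_iff₀ hv]; linarith
      have := pow_le_pow_left₀ h0 this 2
      simp [h]
      linarith
    · have : v⁻¹ * y ≤ 1 := by rw [inv_mul_le_iff₀ hv]; linarith
      have := pow_le_pow_left₀ h0 this 2
      simpa [h] using this
  | succ K ih =>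
    rw [Finset.sum_range_succ]
    by_cases h : v ≤ 2 ^ (K + 1) * y
    · rw [if_pos h]
      have : (0 : ℝ) ≤ (1 / 4) ^ (K + 1) := by positivity
      linarith
    · have h1 : v⁻¹ * y ≤ (1 / 2) ^ (K + 1) := by
        rw [inv_mul_le_iff₀ hv, one_div, inv_pow, ← div_eq_mul_inv, le_div_iff₀ (by positivity)]
        linarith
      have h2 := pow_le_pow_left₀ h0 h1 2
      have h3 : (((1 : ℝ) / 2) ^ (K + 1)) ^ 2 = (1 / 4) ^ (K + 1) := by
        rw [← pow_mul, mul_comm, pow_mul]; norm_num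
      refine (h2.trans_eq h3).trans (le_add_of_nonneg_right ?_)
      refine add_nonneg (add_nonneg (Finset.sum_nonneg fun k _ => ?_) ?_) ?_ <;>
        split_ifs <;> positivity

variable {Ω : Type*} [MeasurableSpace Ω] {μ : Measure Ω} [IsProbabilityMeasure μ]
  {X : Ω → ℝ}

theorem measureReal_le_eq (hX : AEMeasurable X μ) (t : ℝ) :
    μ.real {ω | X ω ≤ t} = cdf (μ.map X) t := by
  have := Measure.isProbabilityMeasure_map hX
  rw [cdf_eq_real, map_measureReal_apply_of_aemeasurable hX measurableSet_Iic]
  rfl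

/-- From `1 - exp(-g) ≤ g`. Having `G` itself as the bound lets probabilities be summed over
coordinates against the Orlicz constraint. -/
theorem measureReal_le_le (hX : AEMeasurable X μ)
    (h : ∀ t : ℝ, 0 ≤ t → cdf (μ.map X) t = 1 - Real.exp (-G t)) {t : ℝ} (ht : 0 ≤ t) :
    μ.real {ω | X ω ≤ t} ≤ G t := by
  rw [measureReal_le_eq hX, h t ht]
  linarith [Real.add_one_le_exp (-G t)]

theorem measure_preimage_Ioi (hX : AEMeasurable X μ)
    (h : ∀ t : ℝ, 0 ≤ t → cdf (μ.map X) t = 1 - Real.exp (-G t)) {t : ℝ} (ht : 0 ≤ t) :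
    μ (X ⁻¹' Set.Ioi t) = ENNReal.ofReal (Real.exp (-G t)) := by
  have := Measure.isProbabilityMeasure_map hX
  rw [← Measure.map_apply_of_aemeasurable hX measurableSet_Ioi, ← Set.compl_Iic,
    ← ofReal_measureReal, probReal_compl_eq_one_sub measurableSet_Iic, ← cdf_eq_real, h t ht,
    sub_sub_cancel]

theorem PropertyP.measureReal_le_zero (hG : PropertyP G) (hX : AEMeasurable X μ)
    (h : ∀ t : ℝ, 0 ≤ t → cdf (μ.map X) t = 1 - Real.exp (-G t)) :
    μ.real {ω | X ω ≤ 0} = 0 :=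
  le_antisymm ((measureReal_le_le hX h le_rfl).trans hG.map_zero.le) measureReal_nonneg

theorem integrable_ite_le (hX : AEMeasurable X μ) (t : ℝ) :
    Integrable (fun ω => if X ω ≤ t then (1 : ℝ) else 0) μ := by
  have hs : NullMeasurableSet {ω | X ω ≤ t} μ := hX.nullMeasurableSet_preimage measurableSet_Iic
  exact (integrable_const (1 : ℝ)).indicator₀ hs

theorem integral_ite_le {ν : Measure Ω} (hX : AEMeasurable X ν) (t : ℝ) :
    ∫ ω, (if X ω ≤ t then (1 : ℝ) else 0) ∂ν = ν.real {ω | X ω ≤ t} := by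
  have hs : NullMeasurableSet {ω | X ω ≤ t} ν := hX.nullMeasurableSet_preimage measurableSet_Iic
  have := integral_indicator₀ (f := fun _ => (1 : ℝ)) hs
  simp only [Set.indicator_apply, Set.mem_ofPred_eq] at this
  rw [this]
  simp

theorem PropertyP.growth (hG : PropertyP G) {C : ℝ}
    (hC : ∀ x y, 0 < x → x < y → G y ≤ C * (y / x) ^ 2 * G x) {t y : ℝ} (ht : 1 < t)
    (hy : 0 ≤ y) : G (t * y) ≤ C * t ^ 2 * G y := by
  rcases hy.eq_or_lt with rfl | hy
  · simp [hG.map_zero]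
  · have h := hC y (t * y) hy (by nlinarith)
    rwa [mul_div_cancel_right₀ _ hy.ne'] at h

theorem integrable_dyadic (hX : AEMeasurable X μ) (y M : ℝ) (K : ℕ) :
    Integrable (fun ω =>
      (∑ k ∈ Finset.range K, (1 / 4) ^ k * if X ω ≤ 2 ^ (k + 1) * y then (1 : ℝ) else 0) +
        M ^ 2 * if X ω ≤ y then 1 else 0) μ :=
  (integrable_finsetSum _ fun _ _ => (integrable_ite_le hX _).const_mul _).add
    ((integrable_ite_le hX _).const_mul _)

/-- Quadratic growth gives `G (2^(k+1) y) ≤ 4 C 4^k G y`, which exactly cancels the weight `4^-k`: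
every level costs `4 C G y`. -/
theorem PropertyP.integral_dyadic_le (hG : PropertyP G) {C : ℝ}
    (hC : ∀ x y, 0 < x → x < y → G y ≤ C * (y / x) ^ 2 * G x) (hX : AEMeasurable X μ)
    (h : ∀ t : ℝ, 0 ≤ t → cdf (μ.map X) t = 1 - Real.exp (-G t)) {y : ℝ} (hy : 0 ≤ y)
    (M : ℝ) (K : ℕ) :
    ∫ ω, ((∑ k ∈ Finset.range K, (1 / 4) ^ k * if X ω ≤ 2 ^ (k + 1) * y then (1 : ℝ) else 0) +
        M ^ 2 * if X ω ≤ y then 1 else 0) ∂μ ≤ (4 * C * K + M ^ 2) * G y := by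
  rw [integral_add (integrable_finsetSum _ fun _ _ => (integrable_ite_le hX _).const_mul _)
    ((integrable_ite_le hX _).const_mul _),
    integral_finsetSum _ fun _ _ => (integrable_ite_le hX _).const_mul _]
  simp only [integral_const_mul, integral_ite_le hX]
  rw [add_mul]
  refine add_le_add ?_ (mul_le_mul_of_nonneg_left (measureReal_le_le hX h hy) (sq_nonneg M))
  calc ∑ k ∈ Finset.range K, (1 / 4 : ℝ) ^ k * μ.real {ω | X ω ≤ 2 ^ (k + 1) * y}
      ≤ ∑ k ∈ Finset.range K, 4 * C * G y := by
        refine Finset.sum_le_sum fun k _ => ?_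
        have h1 := (measureReal_le_le hX h (t := 2 ^ (k + 1) * y) (by positivity)).trans
          (hG.growth hC (one_lt_pow₀ one_lt_two k.succ_ne_zero) hy)
        refine (mul_le_mul_of_nonneg_left h1 (by positivity)).trans (le_of_eq ?_)
        have h2 : ((2 : ℝ) ^ (k + 1)) ^ 2 = 4 * 4 ^ k := by
          rw [← pow_mul, mul_comm, pow_mul]; norm_num [pow_succ]; ring
        rw [h2, one_div, inv_pow]
        field_simp
    _ = 4 * C * K * G y := by simp; ring

/-- Markov's inequality for a strict upper level set. -/
theorem measureReal_lt_le_div {f : Ω → ℝ} (h0 : ∀ ω, 0 ≤ f ω) (hf : Integrable f μ) {T : ℝ}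
    (hT : 0 < T) : μ.real {ω | T < f ω} ≤ (∫ ω, f ω ∂μ) / T := by
  rw [le_div_iff₀' hT]
  refine le_trans (mul_le_mul_of_nonneg_left (measureReal_mono fun ω hω => ?_) hT.le)
    (mul_meas_ge_le_integral_of_nonneg (ae_of_all _ h0) hf T)
  have hω' : T < f ω := hω
  exact hω'.le

variable {u : Fin n → Ω → ℝ}

/-- Small-ball estimate: all of the ratios `|y i| / u i` are small only with exponentially small
probability. -/
theorem PropertyP.measureReal_forall_lt_le (hG : PropertyP G) (hu : ∀ i, AEMeasurable (u i) μ)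
    (hind : iIndepFun u μ)
    (hcdf : ∀ i, ∀ t : ℝ, 0 ≤ t → cdf (μ.map (u i)) t = 1 - Real.exp (-G t))
    {y : Fin n → ℝ} (hy : 1 / 2 ≤ orliczNorm G y) {K : ℝ} (hK : 4 ≤ K) :
    μ.real {ω | ∀ i, K * |y i| < u i ω} ≤ Real.exp (-(K / 4)) := by
  have hK0 : ∀ i, 0 ≤ K * |y i| := fun i => by positivity
  have hset : {ω | ∀ i, K * |y i| < u i ω} = ⋂ i, u i ⁻¹' Set.Ioi (K * |y i|) := by
    ext ω; simp
  have hprod : μ.real {ω | ∀ i, K * |y i| < u i ω} = Real.exp (∑ i, -G (K * |y i|)) := by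
    rw [hset, measureReal_def, hind.meas_iInter fun i => ⟨_, measurableSet_Ioi, rfl⟩,
      ENNReal.toReal_prod, Real.exp_sum]
    refine Finset.prod_congr rfl fun i _ => ?_
    rw [measure_preimage_Ioi (hu i) (hcdf i) (hK0 i), ENNReal.toReal_ofReal (Real.exp_pos _).le]
  rw [hprod, Real.exp_le_exp, Finset.sum_neg_distrib, neg_le_neg_iff]
  -- A sum below one at scale `1/4` would force norm at most `1/4`. Convexity then pulls out the
  -- factor `K / 4 ≥ 1`.
  have h1 : 1 ≤ ∑ i, G (|y i| / (1 / 4)) := by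
    by_contra! hlt
    linarith [orliczNorm_le (by norm_num) hlt.le]
  calc K / 4 ≤ K / 4 * ∑ i, G (|y i| / (1 / 4)) := le_mul_of_one_le_right (by positivity) h1
    _ ≤ ∑ i, G (K * |y i|) := by
      rw [Finset.mul_sum]
      refine Finset.sum_le_sum fun i _ => ?_
      refine (hG.mul_le_apply (by linarith) (by positivity)).trans (le_of_eq ?_)
      congr 1
      ring

/-- Upper bound on the Euclidean norms of the rescaled vectors of a family in the Orlicz ball. -/
theorem PropertyP.measureReal_sum_l2Norm_le (hG : PropertyP G) {C : ℝ} (hC1 : 1 ≤ C)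
    (hC : ∀ x y, 0 < x → x < y → G y ≤ C * (y / x) ^ 2 * G x)
    (hn : 2 ≤ n) (hu : ∀ i, AEMeasurable (u i) μ)
    (hcdf : ∀ i, ∀ t : ℝ, 0 ≤ t → cdf (μ.map (u i)) t = 1 - Real.exp (-G t))
    {d : ℕ} (hd : 1 ≤ d) {U : Fin d → Fin n → ℝ} (hU : ∀ j, orliczNorm G (U j) ≤ 1) :
    μ.real {ω | (∀ i, 0 < u i ω) ∧
      10000 * C * d ^ 2 * Real.log n < ∑ j, l2Norm ((fun i => (u i ω)⁻¹) * U j)} ≤ 1 / 100 := by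
  have hd' : (1 : ℝ) ≤ d := by exact_mod_cast hd
  have hn' : (2 : ℝ) ≤ n := by exact_mod_cast hn
  obtain ⟨l, hl⟩ : ∃ l, l = Real.log n := ⟨_, rfl⟩
  have hl0 : 0.69 ≤ l := by
    rw [hl]
    linarith [Real.log_le_log two_pos hn', Real.log_two_gt_d9]
  -- With `K = ⌈log n⌉` levels the leftovers `4^-K` of all `n` coordinates sum to at most one, since
  -- `e < 4`.
  obtain ⟨K, hKl, hKn⟩ : ∃ K : ℕ, (K : ℝ) ≤ 3 * l ∧ (n : ℝ) * (1 / 4) ^ K ≤ 1 := by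
    refine ⟨⌈l⌉₊, by linarith [Nat.ceil_lt_add_one (show 0 ≤ l by linarith)], ?_⟩
    rw [one_div, inv_pow, ← div_eq_mul_inv, div_le_one (by positivity)]
    calc (n : ℝ) = Real.exp l := by rw [hl, Real.exp_log (by linarith)]
      _ ≤ Real.exp (⌈l⌉₊ * 1) := Real.exp_le_exp.2 (by simpa using Nat.le_ceil l)
      _ = Real.exp 1 ^ ⌈l⌉₊ := Real.exp_nat_mul _ _
      _ ≤ 4 ^ ⌈l⌉₊ := by gcongr; linarith [Real.exp_one_lt_d9]
  -- Truncation height: some ratio reaches `M` with probability at most `d / M = 1/200`.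
  obtain ⟨M, hM⟩ : ∃ M : ℝ, M = 200 * d := ⟨_, rfl⟩
  have hM1 : 1 ≤ M := by linarith
  have hE : 0 < 4 * C * K + M ^ 2 := by positivity
  -- Halving gives strict room below scale 2, so `∑ G ≤ 1` holds without attainment; it costs a
  -- factor 4 in the squares.
  obtain ⟨y, hy⟩ : ∃ y : Fin d → Fin n → ℝ, y = fun j i => |U j i| / 2 := ⟨_, rfl⟩
  have hy0 : ∀ j i, 0 ≤ y j i := fun j i => by rw [hy]; positivity
  have hyG : ∀ j, ∑ i, G (y j i) ≤ 1 := fun j => by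
    rw [hy]; exact hG.sum_le_one_of_lt ((hU j).trans_lt one_lt_two)
  let f : Ω → ℝ := fun ω => ∑ j, ∑ i,
    ((∑ k ∈ Finset.range K, (1 / 4) ^ k * if u i ω ≤ 2 ^ (k + 1) * y j i then (1 : ℝ) else 0) +
        M ^ 2 * if u i ω ≤ y j i then 1 else 0)
  have hf0 : ∀ ω, 0 ≤ f ω := fun ω => by
    refine Finset.sum_nonneg fun j _ => Finset.sum_nonneg fun i _ =>
      add_nonneg (Finset.sum_nonneg fun k _ => ?_) ?_ <;> split_ifs <;> positivity
  have hfi : Integrable f μ := integrable_finsetSum _ fun j _ => integrable_finsetSum _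
    fun i _ => integrable_dyadic (hu i) _ _ _
  have hfE : ∫ ω, f ω ∂μ ≤ d * (4 * C * K + M ^ 2) := by
    rw [integral_finsetSum _ fun j _ => integrable_finsetSum _
      fun i _ => integrable_dyadic (hu i) _ _ _]
    refine le_of_le_of_eq (Finset.sum_le_sum fun j _ => ?_)
      (b := ∑ _j : Fin d, (4 * C * K + M ^ 2)) (by simp [mul_add])
    rw [integral_finsetSum _ fun i _ => integrable_dyadic (hu i) _ _ _]
    refine (Finset.sum_le_sum fun i _ =>
      hG.integral_dyadic_le hC (hu i) (hcdf i) (hy0 j i) M K).trans ?_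
    rw [← Finset.mul_sum]
    exact mul_le_of_le_one_right hE.le (hyG j)
  obtain ⟨T, hT⟩ : ∃ T : ℝ, T = 200 * (d * (4 * C * K + M ^ 2)) := ⟨_, rfl⟩
  have hT0 : 0 < T := by rw [hT]; positivity
  have hMarkov : μ.real {ω | T < f ω} ≤ 1 / 200 := by
    refine (measureReal_lt_le_div hf0 hfi hT0).trans ?_
    rw [div_le_iff₀ hT0]
    linarith
  have hLarge : μ.real (⋃ j, ⋃ i, {ω | u i ω ≤ M⁻¹ * y j i}) ≤ 1 / 200 := by
    refine (measureReal_iUnion_fintype_le _).trans ?_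
    refine le_of_le_of_eq (Finset.sum_le_sum fun j _ => ?_)
      (b := ∑ _j : Fin d, M⁻¹) (by rw [hM]; simp; field_simp)
    refine (measureReal_iUnion_fintype_le _).trans ?_
    refine (Finset.sum_le_sum fun i _ => (measureReal_le_le (hu i) (hcdf i)
      (mul_nonneg (by positivity) (hy0 j i))).trans (hG.apply_mul_le (by positivity)
        (inv_le_one_of_one_le₀ hM1) (hy0 j i))).trans ?_
    rw [← Finset.mul_sum]
    exact mul_le_of_le_one_right (by positivity) (hyG j)
  refine (measureReal_mono (s₂ := {ω | T < f ω} ∪ ⋃ j, ⋃ i, {ω | u i ω ≤ M⁻¹ * y j i}) ?_).trans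
    ((measureReal_union_le _ _).trans (by linarith))
  rintro ω ⟨hpos, hω⟩
  by_contra hcon
  simp only [Set.mem_union, Set.mem_ofPred_eq, Set.mem_iUnion, not_or, not_exists, not_lt,
    not_le] at hcon
  obtain ⟨hfT, hlt⟩ := hcon
  refine hω.not_ge ?_
  have hW : ∑ j, l2Norm ((fun i => (u i ω)⁻¹) * U j) ^ 2 ≤ 4 * (d + T) := by
    have h1 : ∑ j, l2Norm ((fun i => (u i ω)⁻¹) * U j) ^ 2 =
        4 * ∑ j, ∑ i, ((u i ω)⁻¹ * y j i) ^ 2 := by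
      rw [Finset.mul_sum]
      refine Finset.sum_congr rfl fun j _ => ?_
      rw [l2Norm_sq, Finset.mul_sum]
      refine Finset.sum_congr rfl fun i _ => ?_
      rw [hy, Pi.mul_apply, mul_pow, mul_pow, div_pow, sq_abs]
      ring
    rw [h1]
    refine mul_le_mul_of_nonneg_left ?_ (by norm_num)
    calc ∑ j, ∑ i, ((u i ω)⁻¹ * y j i) ^ 2
        ≤ ∑ j : Fin d, ∑ i : Fin n, ((1 / 4) ^ K + _) :=
          Finset.sum_le_sum fun j _ => Finset.sum_le_sum fun i _ =>
            sq_inv_mul_le (hy0 j i) (hpos i)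
              ((inv_mul_le_iff₀ (by positivity)).1 (hlt j i).le) K
      _ = d * (n * (1 / 4) ^ K) + f ω := by
          simp [Finset.sum_add_distrib, f]
      _ ≤ d + T := by
          gcongr
          exact mul_le_of_le_one_right (by positivity) hKn
  -- Cauchy–Schwarz over the `d` vectors; with `M ^ 2 ~ d ^ 2` and `T ~ d ^ 3`, this produces `d ^
  -- 4` under the square root.
  have hcs := sq_sum_le_card_mul_sum_sq (s := Finset.univ)
    (f := fun j => l2Norm ((fun i => (u i ω)⁻¹) * U j))
  rw [Finset.card_univ, Fintype.card_fin] at hcs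
  refine abs_le_of_sq_le_sq' (hcs.trans ((mul_le_mul_of_nonneg_left hW (by positivity)).trans ?_))
    (by rw [← hl]; positivity) |>.2
  rw [← hl, hT, hM]
  -- Every term is weakened to a multiple of `C ^ 2 * l ^ 2 * d ^ 2`, using `l ≥ 0.69`, so that the
  -- bound becomes a perfect square.
  have e1 : (1 : ℝ) ≤ 2.2 * l ^ 2 := by nlinarith
  have e2 : (K : ℝ) ≤ 4.5 * l ^ 2 := by nlinarith
  have e3 : C ≤ C ^ 2 := by nlinarith
  have e4 : (1 : ℝ) ≤ (d : ℝ) ^ 2 := by nlinarith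
  have e5 : (1 : ℝ) ≤ C ^ 2 := by nlinarith
  have e6 : C * K ≤ 4.5 * (C ^ 2 * l ^ 2 * d ^ 2) := by
    calc C * K ≤ C ^ 2 * (4.5 * l ^ 2) := by gcongr
      _ ≤ C ^ 2 * (4.5 * l ^ 2) * d ^ 2 := le_mul_of_one_le_right (by positivity) e4
      _ = _ := by ring
  have e7 : (d : ℝ) ^ 2 ≤ 2.2 * (C ^ 2 * l ^ 2 * d ^ 2) := by
    calc (d : ℝ) ^ 2 ≤ C ^ 2 * (2.2 * l ^ 2) * d ^ 2 :=
          le_mul_of_one_le_left (by positivity) (one_le_mul_of_one_le_of_one_le e5 e1)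
      _ = _ := by ring
  calc (d : ℝ) * (4 * (d + 200 * (d * (4 * C * K + (200 * d) ^ 2))))
      = 4 * d ^ 2 * (1 + 800 * (C * K) + 8000000 * d ^ 2) := by ring
    _ ≤ 4 * d ^ 2 * (25000000 * (C ^ 2 * l ^ 2 * d ^ 2)) := by
        gcongr
        linarith
    _ = (10000 * C * d ^ 2 * l) ^ 2 := by ring

end OrliczEmbedding

/-! ### The coefficient grid and the union bound over it. -/

namespace OrliczEmbedding

open MeasureTheory ProbabilityTheory

variable {G : ℝ → ℝ} {n : ℕ}

/-- A point of the cube `[-1, 1]` is within `1 / L` of the grid of mesh `1 / L`. -/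
theorem exists_grid_approx {L : ℕ} (hL : 0 < L) {w : ℝ} (hw : |w| ≤ 1) :
    ∃ k : Fin (2 * L + 1), |w - ((k : ℝ) - L) / L| ≤ 1 / L := by
  obtain ⟨h1, h2⟩ := abs_le.1 hw
  have hL' : (0 : ℝ) < L := by exact_mod_cast hL
  have hnn : 0 ≤ (w + 1) * L := mul_nonneg (by linarith) hL'.le
  have hk : ⌊(w + 1) * L⌋₊ < 2 * L + 1 := by
    rw [Nat.lt_succ_iff]
    refine Nat.floor_le_of_le ?_
    push_cast
    nlinarith
  refine ⟨⟨_, hk⟩, ?_⟩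
  have e1 := Nat.floor_le hnn
  have e2 := Nat.lt_floor_add_one ((w + 1) * L)
  have e3 : w - ((⌊(w + 1) * L⌋₊ : ℝ) - L) / L = ((w + 1) * L - ⌊(w + 1) * L⌋₊) / L := by
    field_simp
    ring
  rw [e3, abs_div, abs_of_pos hL']
  exact div_le_div_of_nonneg_right (abs_le.2 ⟨by linarith, by linarith⟩) hL'.le

/-- Grid points in the span of a family of `d` vectors. -/
noncomputable def gridPoint {d : ℕ} (U : Fin d → Fin n → ℝ) (L : ℕ)
    (k : Fin d → Fin (2 * L + 1)) : Fin n → ℝ :=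
  ∑ j, ((((k j : ℕ) : ℝ) - L) / (L : ℝ)) • U j

/-- Deterministic lower bound: no contraction on a grid, together with an upper bound on the
spanning family, implies no contraction on the whole span. -/
theorem PropertyP.le_l2Norm_of_grid (hG : PropertyP G) {d L : ℕ} {U : Fin d → Fin n → ℝ}
    {v : Fin n → ℝ} {B K : ℝ} (hL : 0 < L) (hdL : 2 * d ≤ L) (hBL : 2 * K * B ≤ L) (hK : 0 < K)
    (hv : ∀ i, 0 < v i) (hU : ∀ j, orliczNorm G (U j) ≤ 1)
    (hB : ∑ j, l2Norm ((fun i => (v i)⁻¹) * U j) ≤ B)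
    (hgrid : ∀ k, 1 / 2 ≤ orliczNorm G (gridPoint U L k) →
      ∃ i, v i ≤ K * |gridPoint U L k i|)
    {y : Fin n → ℝ} {z : Fin d → ℝ} (hy : y = ∑ j, z j • U j)
    (hz : ∀ j, |z j| ≤ orliczNorm G y) :
    1 / (2 * K) * orliczNorm G y ≤ l2Norm ((fun i => (v i)⁻¹) * y) := by
  rcases (orliczNorm_nonneg (G := G) y).eq_or_lt with hr | hr
  · rw [← hr, mul_zero]; exact l2Norm_nonneg _
  obtain ⟨r, hrdef⟩ : ∃ r, r = orliczNorm G y := ⟨_, rfl⟩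
  rw [← hrdef] at hr hz ⊢
  have hL' : (0 : ℝ) < L := by exact_mod_cast hL
  have hw : ∀ j, |r⁻¹ * z j| ≤ 1 := fun j => by
    rw [abs_mul, abs_of_pos (inv_pos.2 hr), inv_mul_le_iff₀ hr, mul_one]; exact hz j
  -- Round the coefficients of `y / ‖y‖`. The Orlicz error is at most `d / L ≤ 1/2`, so the grid
  -- point keeps norm at least `1/2`; the Euclidean error after rescaling is at most `B / L ≤
  -- 1/(2K)`, half of the grid lower bound `1/K`.
  choose k hk using fun j => exists_grid_approx hL (hw j)
  have hdiff : r⁻¹ • y = gridPoint U L k +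
      ∑ j, (r⁻¹ * z j - (((k j : ℕ) : ℝ) - L) / (L : ℝ)) • U j := by
    rw [hy, gridPoint, ← Finset.sum_add_distrib, Finset.smul_sum]
    refine Finset.sum_congr rfl fun j _ => ?_
    rw [← add_smul, smul_smul, add_sub_cancel]
  have hnorm : orliczNorm G (r⁻¹ • y) = 1 := by
    rw [hG.orliczNorm_smul, abs_of_pos (inv_pos.2 hr), ← hrdef, inv_mul_cancel₀ hr.ne']
  have hhalf : 1 / 2 ≤ orliczNorm G (gridPoint U L k) := by
    have h1 := hG.orliczNorm_add_le (gridPoint U L k)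
      (∑ j, (r⁻¹ * z j - (((k j : ℕ) : ℝ) - L) / (L : ℝ)) • U j)
    rw [← hdiff, hnorm] at h1
    have h2 := hG.orliczNorm_sum_smul_le hU hk
    have h3 : (d : ℝ) * (1 / L) ≤ 1 / 2 := by
      rw [mul_one_div, div_le_div_iff₀ hL' two_pos]
      have : (2 : ℝ) * d ≤ L := by exact_mod_cast hdL
      linarith
    linarith
  obtain ⟨i, hi⟩ := hgrid k hhalf
  have hlow : 1 / K ≤ l2Norm ((fun i => (v i)⁻¹) * gridPoint U L k) := by
    refine le_trans ?_ (abs_le_l2Norm _ i)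
    rw [Pi.mul_apply, abs_mul, abs_of_pos (inv_pos.2 (hv i)), div_le_iff₀ hK, mul_assoc,
      le_inv_mul_iff₀ (hv i)]
    linarith
  have hup : l2Norm ((fun i => (v i)⁻¹) *
      ∑ j, (r⁻¹ * z j - (((k j : ℕ) : ℝ) - L) / (L : ℝ)) • U j) ≤ 1 / (2 * K) := by
    refine (l2Norm_mul_sum_smul_le _ U (by positivity) hk hB).trans ?_
    rw [one_div_mul_eq_div, div_le_div_iff₀ hL' (by positivity)]
    linarith
  have hsplit : (fun i => (v i)⁻¹) * gridPoint U L k = r⁻¹ • ((fun i => (v i)⁻¹) * y) +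
      (-1 : ℝ) • ((fun i => (v i)⁻¹) *
        ∑ j, (r⁻¹ * z j - (((k j : ℕ) : ℝ) - L) / (L : ℝ)) • U j) := by
    rw [← mul_smul_comm, hdiff, mul_add, neg_one_smul, add_neg_cancel_right]
  have htri := l2Norm_add_le (r⁻¹ • ((fun i => (v i)⁻¹) * y)) ((-1 : ℝ) • ((fun i => (v i)⁻¹) *
        ∑ j, (r⁻¹ * z j - (((k j : ℕ) : ℝ) - L) / (L : ℝ)) • U j))
  rw [← hsplit, l2Norm_smul, l2Norm_smul, abs_of_pos (inv_pos.2 hr), abs_neg, abs_one,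
    one_mul] at htri
  have hfin : 1 / (2 * K) ≤ r⁻¹ * l2Norm ((fun i => (v i)⁻¹) * y) := by
    have : 1 / K = 1 / (2 * K) + 1 / (2 * K) := by field_simp; norm_num
    linarith
  rwa [le_inv_mul_iff₀ hr, mul_comm] at hfin

/-- An exponent for which the net of polynomial size is beaten by the small-ball estimate. -/
theorem exists_exponent (C : ℝ) (hC : 1 ≤ C) :
    ∃ q : ℕ, 6 ≤ q ∧ ∀ n : ℕ, 2 ≤ n → 200 * (160000 * q * C + 7) * (n : ℝ) ^ 5 ≤ (n : ℝ) ^ q := by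
  -- With `q = p + 5` and `p ≥ 1`, `160000 q C + 7 ≤ (960000 C + 7) p`; since `p / 2^p → 0`, a large
  -- `p` makes 200 times this at most `2^p ≤ n^p`.
  have hR : 0 < 200 * (960000 * C + 7) := by linarith
  have ht := tendsto_pow_const_div_const_pow_of_one_lt 1 (r := (2 : ℝ)) one_lt_two
  have hev := ht.eventually (gt_mem_nhds (show 0 < 1 / (200 * (960000 * C + 7)) by positivity))
  obtain ⟨p, hp, hp1⟩ := (hev.and (eventually_ge_atTop 1)).exists
  refine ⟨p + 5, by omega, fun n hn => ?_⟩
  have hn' : (2 : ℝ) ≤ n := by exact_mod_cast hn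
  have hp1' : (1 : ℝ) ≤ p := by exact_mod_cast hp1
  rw [pow_one, div_lt_div_iff₀ (by positivity) hR, one_mul] at hp
  rw [pow_add]
  refine mul_le_mul_of_nonneg_right ?_ (by positivity)
  have h2 : (2 : ℝ) ^ p ≤ (n : ℝ) ^ p := by gcongr
  push_cast
  nlinarith

variable {Ω : Type*} [MeasurableSpace Ω] {μ : Measure Ω} [IsProbabilityMeasure μ]
  {u : Fin n → Ω → ℝ}

/-- Union bound for the complement. -/
theorem one_sub_add_le_measureReal {s t₁ t₂ : Set Ω} {a b : ℝ} (h₁ : μ.real t₁ ≤ a)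
    (h₂ : μ.real t₂ ≤ b) (h : ∀ ω, ω ∉ t₁ → ω ∉ t₂ → ω ∈ s) : 1 - (a + b) ≤ μ.real s := by
  -- Only subadditivity is used, so the events need not be measurable.
  have hu : (Set.univ : Set Ω) ⊆ s ∪ (t₁ ∪ t₂) := fun ω _ => by
    by_cases h₁ : ω ∈ t₁
    · exact Or.inr (Or.inl h₁)
    by_cases h₂ : ω ∈ t₂
    · exact Or.inr (Or.inr h₂)
    exact Or.inl (h ω h₁ h₂)
  have h3 := measureReal_mono (μ := μ) hu
  rw [probReal_univ] at h3
  linarith [measureReal_union_le (μ := μ) s (t₁ ∪ t₂), measureReal_union_le (μ := μ) t₁ t₂]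

/-- With high probability no vector of the net is contracted too much. -/
theorem PropertyP.measureReal_grid_le (hG : PropertyP G) (hu : ∀ i, AEMeasurable (u i) μ)
    (hind : iIndepFun u μ)
    (hcdf : ∀ i, ∀ t : ℝ, 0 ≤ t → cdf (μ.map (u i)) t = 1 - Real.exp (-G t))
    {d : ℕ} (U : Fin d → Fin n → ℝ) (L : ℕ) {K : ℝ} (hK : 4 ≤ K) :
    μ.real {ω | ∃ k, 1 / 2 ≤ orliczNorm G (gridPoint U L k) ∧
      ∀ i, K * |gridPoint U L k i| < u i ω} ≤ (2 * L + 1) ^ d * Real.exp (-(K / 4)) := by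
  have hsub : {ω | ∃ k, 1 / 2 ≤ orliczNorm G (gridPoint U L k) ∧
      ∀ i, K * |gridPoint U L k i| < u i ω} ⊆ ⋃ k, {ω | 1 / 2 ≤ orliczNorm G (gridPoint U L k) ∧
      ∀ i, K * |gridPoint U L k i| < u i ω} := fun ω ⟨k, hk⟩ => Set.mem_iUnion.2 ⟨k, hk⟩
  refine (measureReal_mono hsub).trans ((measureReal_iUnion_fintype_le _).trans ?_)
  refine le_of_le_of_eq (Finset.sum_le_sum fun k _ => ?_)
    (b := ∑ _k : Fin d → Fin (2 * L + 1), Real.exp (-(K / 4))) (by simp)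
  by_cases h : 1 / 2 ≤ orliczNorm G (gridPoint U L k)
  · simpa only [h, true_and] using hG.measureReal_forall_lt_le hu hind hcdf h hK
  · simp only [h, false_and, Set.ofPred_false, measureReal_empty]
    exact (Real.exp_pos _).le

end OrliczEmbedding

/-! ### Choice of parameters and conclusion. -/

open OrliczEmbedding MeasureTheory ProbabilityTheory in
/-- The embedding bound with the explicit events on which it holds. -/
theorem OrliczEmbedding.PropertyP.embedding {G : ℝ → ℝ} (hG : PropertyP G) {C : ℝ} (hC1 : 1 ≤ C)
    (hC : ∀ x y, 0 < x → x < y → G y ≤ C * (y / x) ^ 2 * G x) {q : ℕ} (hq6 : 6 ≤ q)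
    (hq : ∀ n : ℕ, 2 ≤ n → 200 * (160000 * q * C + 7) * (n : ℝ) ^ 5 ≤ (n : ℝ) ^ q)
    {n m : ℕ} (hn : 2 ≤ n) (A : Matrix (Fin n) (Fin m) ℝ) (hd : 1 ≤ A.rank)
    {Ω : Type*} [MeasurableSpace Ω] {μ : Measure Ω} [IsProbabilityMeasure μ]
    {u : Fin n → Ω → ℝ} (hu : ∀ i, AEMeasurable (u i) μ) (hind : iIndepFun u μ)
    (hcdf : ∀ i, ∀ t : ℝ, 0 ≤ t → cdf (μ.map (u i)) t = 1 - Real.exp (-G t)) :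
    μ.real {ω | (∀ i, 0 < u i ω) ∧ ¬ ∀ x : Fin m → ℝ,
      1 / (8 * q * A.rank * Real.log n) * orliczNorm G (A.mulVec x) ≤
        l2Norm ((fun i => (u i ω)⁻¹) * A.mulVec x) ∧
      l2Norm ((fun i => (u i ω)⁻¹) * A.mulVec x) ≤
        10000 * C * A.rank ^ 2 * Real.log n * orliczNorm G (A.mulVec x)} ≤ 3 / 200 := by
  obtain ⟨U, hU, hspan⟩ := hG.exists_wellConditioned A
  have hn' : (2 : ℝ) ≤ n := by exact_mod_cast hn
  have hdn' : (A.rank : ℝ) ≤ n := by exact_mod_cast A.rank_le_height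
  have hd' : (1 : ℝ) ≤ A.rank := by exact_mod_cast hd
  have hq6' : (6 : ℝ) ≤ q := by exact_mod_cast hq6
  generalize A.rank = d at *
  obtain ⟨l, hl⟩ : ∃ l, l = Real.log n := ⟨_, rfl⟩
  have hl0 : 0.69 ≤ l := by
    rw [hl]
    linarith [Real.log_le_log two_pos hn', Real.log_two_gt_d9]
  have hln : l ≤ n := by rw [hl]; exact Real.log_le_self (by linarith)
  have hupper := hG.measureReal_sum_l2Norm_le hC1 hC hn hu hcdf hd hU
  obtain ⟨B, hBdef⟩ : ∃ B, B = 10000 * C * d ^ 2 * l := ⟨_, rfl⟩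
  rw [← hl, ← hBdef] at hupper ⊢
  have hB0 : 0 < B := by rw [hBdef]; positivity
  -- Chosen so that `exp(-K/4) = n^(-q d)`.
  obtain ⟨K, hKdef⟩ : ∃ K : ℝ, K = 4 * q * d * l := ⟨_, rfl⟩
  have hK4 : 4 ≤ K := by
    have h1 : (1 : ℝ) ≤ q * l := by nlinarith
    have h2 : (1 : ℝ) ≤ q * l * d := one_le_mul_of_one_le_of_one_le h1 hd'
    rw [hKdef]; linarith
  -- The two summands meet the two mesh requirements of the rounding argument. As `d ≤ n` and `log n
  -- ≤ n`, `K * B` is `O(n ^ 5)`, whence the fifth power in `hq`.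
  obtain ⟨L, hLdef⟩ : ∃ L : ℕ, L = ⌈2 * K * B⌉₊ + 2 * d := ⟨_, rfl⟩
  have hLB : 2 * K * B ≤ L := by
    rw [hLdef]; push_cast
    linarith [Nat.le_ceil (2 * K * B)]
  have hLn : 200 * (2 * (L : ℝ) + 1) ≤ (n : ℝ) ^ q := by
    refine le_trans ?_ (hq n hn)
    have h1 : (L : ℝ) ≤ 2 * K * B + 1 + 2 * d := by
      rw [hLdef]; push_cast
      linarith [Nat.ceil_lt_add_one (show 0 ≤ 2 * K * B by positivity)]
    have h2 : K * B ≤ 40000 * q * C * (n : ℝ) ^ 5 := by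
      calc K * B = 40000 * q * C * (d ^ 3 * l ^ 2) := by rw [hKdef, hBdef]; ring
        _ ≤ 40000 * q * C * ((n : ℝ) ^ 3 * (n : ℝ) ^ 2) := by gcongr
        _ = _ := by ring
    have h3 : (n : ℝ) ≤ (n : ℝ) ^ 5 := le_self_pow₀ (by linarith) (by norm_num)
    nlinarith [one_le_pow₀ (show (1 : ℝ) ≤ n by linarith) (n := 5), pow_le_pow_left₀ zero_le_two hn' 5]
  have hgrid := hG.measureReal_grid_le hu hind hcdf U L hK4
  have hgrid' : (2 * (L : ℝ) + 1) ^ d * Real.exp (-(K / 4)) ≤ 1 / 200 := by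
    have hexp : Real.exp (K / 4) = ((n : ℝ) ^ q) ^ d := by
      rw [← pow_mul, ← Real.exp_log (show (0 : ℝ) < (n : ℝ) by linarith), ← Real.exp_nat_mul, ← hl,
        hKdef]
      congr 1
      push_cast
      ring
    rw [Real.exp_neg, hexp, ← div_eq_mul_inv, div_le_iff₀ (by positivity)]
    -- `d ≥ 1` allows the factor 200 to be absorbed in the `d`-th power of `hLn`.
    have h1 : (200 : ℝ) * (2 * L + 1) ^ d ≤ 200 ^ d * (2 * L + 1) ^ d :=
      mul_le_mul_of_nonneg_right (le_self_pow₀ (by norm_num) (by omega)) (by positivity)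
    rw [← mul_pow] at h1
    have h2 := pow_le_pow_left₀ (by positivity) hLn d
    linarith
  refine (measureReal_mono (s₂ := {ω | (∀ i, 0 < u i ω) ∧
      B < ∑ j, l2Norm ((fun i => (u i ω)⁻¹) * U j)} ∪
      {ω | ∃ k, 1 / 2 ≤ orliczNorm G (gridPoint U L k) ∧
        ∀ i, K * |gridPoint U L k i| < u i ω}) ?_).trans
    ((measureReal_union_le _ _).trans (by linarith))
  rintro ω ⟨hpos, hω⟩
  by_contra hcon
  rw [Set.mem_union, not_or] at hcon
  obtain ⟨hcon1, hcon2⟩ := hcon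
  have hB : ∑ j, l2Norm ((fun i => (u i ω)⁻¹) * U j) ≤ B :=
    not_lt.1 fun h => hcon1 ⟨hpos, h⟩
  refine hω fun x => ?_
  obtain ⟨z, hz, hzN⟩ := hspan x
  constructor
  · have h := hG.le_l2Norm_of_grid (by omega) (by omega) hLB (by linarith) hpos hU hB
      (fun k hk => by
        by_contra! hlt
        exact hcon2 ⟨k, hk, hlt⟩) hz hzN
    rwa [hKdef, show 2 * (4 * (q : ℝ) * d * l) = 8 * q * d * l by ring] at h
  · have h := l2Norm_mul_sum_smul_le (fun i => (u i ω)⁻¹) U (orliczNorm_nonneg _) hzN hB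
    rw [← hz] at h
    rwa [mul_comm _ B] at h

theorem theorem13 :
    ∃ c C : ℝ, 0 < c ∧ 0 < C ∧
      ∀ G : ℝ → ℝ, OrliczEmbedding.PropertyP G →
        ∃ α₁ α₂ : ℝ, 1 ≤ α₁ ∧ 1 ≤ α₂ ∧
          ∀ (n m : ℕ), 2 ≤ n → ∀ (A : Matrix (Fin n) (Fin m) ℝ)
            {Ω : Type*} [MeasurableSpace Ω] (μ : MeasureTheory.Measure Ω)
            [MeasureTheory.IsProbabilityMeasure μ] (u : Fin n → Ω → ℝ),
            (∀ i, AEMeasurable (u i) μ) →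
            ProbabilityTheory.iIndepFun u μ →
            (∀ i, ∀ t : ℝ, 0 ≤ t →
              ProbabilityTheory.cdf (μ.map (u i)) t = 1 - Real.exp (-G t)) →
            (0.98 : ℝ) ≤ μ.real {ω : Ω |
              IsUnit (Matrix.diagonal fun i => u i ω) ∧
              ∀ x : Fin m → ℝ,
                c / (α₁ * A.rank * Real.log n) * OrliczEmbedding.orliczNorm G (A.mulVec x) ≤
                  OrliczEmbedding.l2Norm
                    ((Matrix.diagonal fun i => u i ω)⁻¹.mulVec (A.mulVec x)) ∧
                OrliczEmbedding.l2Norm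
                    ((Matrix.diagonal fun i => u i ω)⁻¹.mulVec (A.mulVec x)) ≤
                  C * (α₂ * (A.rank : ℝ) ^ 2 * Real.log n) *
                    OrliczEmbedding.orliczNorm G (A.mulVec x)} := by
  refine ⟨1, 1, one_pos, one_pos, fun G hG => ?_⟩
  obtain ⟨C, hC1, hC⟩ : ∃ C : ℝ, 1 ≤ C ∧
      ∀ x y, 0 < x → x < y → G y ≤ C * (y / x) ^ 2 * G x := by
    obtain ⟨C₀, -, h⟩ := hG.subquadratic
    refine ⟨max 1 C₀, le_max_left _ _, fun x y hx hxy => (h x y hx hxy).trans ?_⟩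
    have := hG.nonneg x
    gcongr
    exact le_max_right _ _
  obtain ⟨q, hq6, hq⟩ := OrliczEmbedding.exists_exponent C hC1
  have hq6' : (6 : ℝ) ≤ q := by exact_mod_cast hq6
  -- All constants go into the two factors depending on `G`, so the absolute ones are 1.
  refine ⟨8 * q, 10000 * C, by linarith, by linarith, ?_⟩
  intro n m hn A Ω _ μ _ u hu hind hcdf
  have hpos0 : μ.real (⋃ i, {ω | u i ω ≤ 0}) ≤ 0 :=
    (MeasureTheory.measureReal_iUnion_fintype_le _).trans
      (by simp [fun i => hG.measureReal_le_zero (hu i) (hcdf i)])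
  have hbad : μ.real {ω | (∀ i, 0 < u i ω) ∧ ¬ ∀ x : Fin m → ℝ,
      1 / (8 * q * A.rank * Real.log n) * OrliczEmbedding.orliczNorm G (A.mulVec x) ≤
        OrliczEmbedding.l2Norm ((fun i => (u i ω)⁻¹) * A.mulVec x) ∧
      OrliczEmbedding.l2Norm ((fun i => (u i ω)⁻¹) * A.mulVec x) ≤
        10000 * C * A.rank ^ 2 * Real.log n * OrliczEmbedding.orliczNorm G (A.mulVec x)} ≤
      3 / 200 := by
    -- In rank zero every `A x` vanishes and all three terms are `0`.
    rcases Nat.eq_zero_or_pos A.rank with hd | hd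
    · have hA : ∀ x, A.mulVec x = 0 := fun x => by
        have hx : A.mulVec x ∈ LinearMap.range A.mulVecLin := ⟨x, rfl⟩
        rwa [Submodule.finrank_eq_zero.1 hd, Submodule.mem_bot] at hx
      simp only [hA, mul_zero, hG.orliczNorm_zero, OrliczEmbedding.l2Norm_zero,
        le_refl, and_self, implies_true, not_true_eq_false, and_false, Set.ofPred_false,
        MeasureTheory.measureReal_empty]
      norm_num
    · exact hG.embedding hC1 hC hq6 hq hn A hd hu hind hcdf
  -- The total failure probability is at most `0 + 3/200 < 0.02`.
  refine le_trans (by norm_num)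
    (OrliczEmbedding.one_sub_add_le_measureReal hpos0 hbad fun ω hω1 hω2 => ?_)
  have hpos : ∀ i, 0 < u i ω := fun i =>
    not_le.1 fun h => hω1 (Set.mem_iUnion.2 ⟨i, h⟩)
  have hgood := not_not.1 fun h => hω2 ⟨hpos, h⟩
  have hinv : (Matrix.diagonal fun i => u i ω)⁻¹ = Matrix.diagonal fun i => (u i ω)⁻¹ := by
    refine Matrix.inv_eq_right_inv ?_
    simp [Matrix.diagonal_mul_diagonal, (hpos _).ne']
  refine ⟨?_, fun x => ?_⟩
  · rw [Matrix.isUnit_diagonal, Pi.isUnit_iff]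
    exact fun i => isUnit_iff_ne_zero.2 (hpos i).ne'
  · have hmul : (Matrix.diagonal fun i => u i ω)⁻¹.mulVec (A.mulVec x) =
        (fun i => (u i ω)⁻¹) * A.mulVec x := by
      rw [hinv]
      funext i
      rw [Matrix.mulVec_diagonal, Pi.mul_apply]
    rw [hmul, one_mul]
    exact hgood x
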